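/- Call a set of three non-collinear points of a finite point set $P$ in the Euclidean plane $\mathbb{R}^2$ a *$c$-ordinary triangle* in $P$ if each of the three lines determined by two of these three points contains at most $c$ points of $P$. Theorem. There exist a natural number $c$ and a real number $\delta>0$ (both absolute) with the following property. Let $P$ be a finite set of points in the Euclidean plane that is not contained in the union of two lines. Then $P$ contains a $c$-ordinary triangle. Moreover, the number of $c$-ordinary triangles in $P$ is at least $\delta\,|P|$ (that is, it is $\Omega(|P|)$). -/

import Mathlib

/-- The Euclidean plane. -/
abbrev Plane : Type := EuclideanSpace ℝ (Fin 2)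

/-- An affine subspace of the plane is a line if it is nonempty and its direction has
dimension one. -/
def IsLine (L : AffineSubspace ℝ Plane) : Prop :=
  (L : Set Plane).Nonempty ∧ Module.finrank ℝ L.direction = 1

/-- The point set `P` is contained in the union of two lines. -/
def CoveredByTwoLines (P : Finset Plane) : Prop :=
  ∃ L₁ L₂ : AffineSubspace ℝ Plane, IsLine L₁ ∧ IsLine L₂ ∧
    (P : Set Plane) ⊆ (L₁ : Set Plane) ∪ (L₂ : Set Plane)

/-- `T` is a `c`-ordinary triangle in `P`: a subset of `P` consisting of three non-collinear
points such that each of the three lines through two of these points contains at most `c`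
points of `P`. -/
def IsOrdinaryTriangle (c : ℕ) (P T : Finset Plane) : Prop :=
  T ⊆ P ∧ T.card = 3 ∧ ¬ Collinear ℝ (T : Set Plane) ∧
    ∀ p ∈ T, ∀ q ∈ T, p ≠ q → ((P : Set Plane) ∩ (line[ℝ, p, q] : Set Plane)).ncard ≤ c

open Classical in
/-- The finite set of all `c`-ordinary triangles in `P`. -/
noncomputable def ordinaryTriangles (c : ℕ) (P : Finset Plane) : Finset (Finset Plane) :=
  P.powerset.filter (fun T => IsOrdinaryTriangle c P T)

/-! Write `n` for the number of points. The proof is a dichotomy on the richest line.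

If some line `L` carries more than about `n / 1000` points, the points off `L` are not collinear,
since otherwise two lines would cover everything. Sylvester–Gallai gives `a`, `b` off `L` whose line
contains no other point off `L`, hence at most three points in all. Rich lines through `a` that meet
`P` on `L` are disjoint away from `a`, so only about `n / c` of them exist, and likewise for `b`.
Hence most points `p` of `L` make `a b p` an ordinary triangle
(`card_linePoints_le_of_not_covered`).

If every line is poorer than that, the Szemerédi–Trotter bound, summed over all richness levels,
shows that pairs of points on lines with more than `c` points are a small fraction of all `n ^ 2`
pairs (`card_richPairs_le`). Deleting triples that are degenerate, collinear or contain such a pair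
then leaves cubically many ordinary triangles (`card_ordinaryTriangles_of_richPairs`).

Szemerédi–Trotter is proved by the crossing argument: a non-crossing straight-line graph has at most
`3 n` edges, random sampling of vertices amplifies this to a crossing inequality, and the latter is
applied to segments between consecutive points on the lines. The edge bound uses a charging argument
on wedges instead of Euler's formula. -/

/-- Slope of the segment from `e.1` to `e.2`, for points with coordinates `X`, `Y`. -/
noncomputable def segSlope {ι : Type*} (X Y : ι → ℝ) (e : ι × ι) : ℝ :=
  (Y e.2 - Y e.1) / (X e.2 - X e.1)

/-- The affine function whose graph is the line through `e.1` and `e.2`. -/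
noncomputable def segHeight {ι : Type*} (X Y : ι → ℝ) (e : ι × ι) (x : ℝ) : ℝ :=
  Y e.1 + segSlope X Y e * (x - X e.1)

/-- The open segments `e` and `f`, both directed to the right, have a common point. -/
def SegCross {ι : Type*} (X Y : ι → ℝ) (e f : ι × ι) : Prop :=
  ∃ x, X e.1 < x ∧ X f.1 < x ∧ x < X e.2 ∧ x < X f.2 ∧ segHeight X Y e x = segHeight X Y f x

/-! ### Edge bound for non-crossing straight-line graphs. -/

section Planar

variable {ι : Type*} {X Y : ι → ℝ}

theorem segHeight_left (e : ι × ι) : segHeight X Y e (X e.1) = Y e.1 := by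
  simp [segHeight]

theorem segHeight_right {e : ι × ι} (h : X e.1 < X e.2) : segHeight X Y e (X e.2) = Y e.2 := by
  have : X e.2 - X e.1 ≠ 0 := by linarith
  simp only [segHeight, segSlope]
  field_simp
  ring

/-- A segment that starts above a non-crossing one stays above it. -/
theorem segHeight_le_of_not_cross {e f : ι × ι} (h : ¬ SegCross X Y e f) {x y : ℝ}
    (hex : X e.1 ≤ x) (hfx : X f.1 ≤ x) (hxy : x < y) (hey : y ≤ X e.2) (hfy : y ≤ X f.2)
    (hx : segHeight X Y e x < segHeight X Y f x) :
    segHeight X Y e y ≤ segHeight X Y f y := by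
  by_contra! hy
  apply h
  set u := segHeight X Y f x - segHeight X Y e x with hu
  set v := segHeight X Y e y - segHeight X Y f y with hv
  have hu0 : 0 < u := by linarith
  have hv0 : 0 < v := by linarith
  have huv : 0 < u + v := by linarith
  -- The height difference is affine, going from `u` at `x` to `-v` at `y`; this is its zero.
  refine ⟨x + u / (u + v) * (y - x), ?_, ?_, ?_, ?_, ?_⟩
  · have : 0 < u / (u + v) * (y - x) := mul_pos (div_pos hu0 huv) (by linarith)
    linarith
  · have : 0 < u / (u + v) * (y - x) := mul_pos (div_pos hu0 huv) (by linarith)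
    linarith
  · have : u / (u + v) * (y - x) < 1 * (y - x) :=
      mul_lt_mul_of_pos_right ((div_lt_one huv).2 (by linarith)) (by linarith)
    linarith
  · have : u / (u + v) * (y - x) < 1 * (y - x) :=
      mul_lt_mul_of_pos_right ((div_lt_one huv).2 (by linarith)) (by linarith)
    linarith
  · have key : u + v = (segSlope X Y e - segSlope X Y f) * (y - x) := by
      rw [hu, hv]; simp only [segHeight]; ring
    have h2 : segHeight X Y e (x + u / (u + v) * (y - x)) -
        segHeight X Y f (x + u / (u + v) * (y - x)) =
        - u + u / (u + v) * ((segSlope X Y e - segSlope X Y f) * (y - x)) := by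
      rw [hu]; simp only [segHeight]; ring
    rw [← key, div_mul_cancel₀ _ huv.ne'] at h2
    linarith

theorem segHeight_le_of_slope_le {e f : ι × ι} (h : e.1 = f.1)
    (hs : segSlope X Y e ≤ segSlope X Y f) {x : ℝ} (hx : X e.1 ≤ x) :
    segHeight X Y e x ≤ segHeight X Y f x := by
  simp only [segHeight, ← h]
  have := mul_le_mul_of_nonneg_right hs (sub_nonneg.2 hx)
  linarith

theorem segHeight_lt_of_slope_lt {e f : ι × ι} (h : e.1 = f.1)
    (hs : segSlope X Y e < segSlope X Y f) {x : ℝ} (hx : X e.1 < x) :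
    segHeight X Y e x < segHeight X Y f x := by
  simp only [segHeight, ← h]
  have := mul_lt_mul_of_pos_right hs (sub_pos.2 hx)
  linarith

/-- `w` is the leftmost point of `P` in the closed wedge between the segments `e` and `f` that
emanate from a common point. -/
structure IsWedgeApex (X Y : ι → ℝ) (P : Finset ι) (E : Finset (ι × ι)) (e f : ι × ι) (w : ι) :
    Prop where
  memE : e ∈ E
  memF : f ∈ E
  fst_eq : e.1 = f.1
  slope_lt : segSlope X Y e < segSlope X Y f
  next : ∀ g ∈ E, g.1 = e.1 → segSlope X Y e < segSlope X Y g → segSlope X Y f ≤ segSlope X Y g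
  mem : w ∈ P
  left_lt : X e.1 < X w
  le_e : X w ≤ X e.2
  le_f : X w ≤ X f.2
  above : segHeight X Y e (X w) ≤ Y w
  below : Y w ≤ segHeight X Y f (X w)
  first : ∀ v ∈ P, X e.1 < X v → X v < X w →
    Y v < segHeight X Y e (X v) ∨ segHeight X Y f (X v) < Y v

variable {P : Finset ι} {E : Finset (ι × ι)}

/-- The shorter (in abscissa) of the two edges ends inside the closed wedge, so there are candidates
to minimise over. -/
theorem exists_isWedgeApex (hE : ∀ e ∈ E, e.1 ∈ P ∧ e.2 ∈ P ∧ X e.1 < X e.2)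
    {e f : ι × ι} (he : e ∈ E) (hf : f ∈ E) (hef : e.1 = f.1)
    (hs : segSlope X Y e < segSlope X Y f)
    (hn : ∀ g ∈ E, g.1 = e.1 → segSlope X Y e < segSlope X Y g →
      segSlope X Y f ≤ segSlope X Y g) :
    ∃ w, IsWedgeApex X Y P E e f w := by
  classical
  set W := P.filter (fun w => X e.1 < X w ∧ X w ≤ X e.2 ∧ X w ≤ X f.2 ∧
    segHeight X Y e (X w) ≤ Y w ∧ Y w ≤ segHeight X Y f (X w)) with hW
  have he' := hE e he
  have hf' := hE f hf
  have hne : W.Nonempty := by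
    rcases le_total (X e.2) (X f.2) with h | h
    · refine ⟨e.2, ?_⟩
      rw [hW, Finset.mem_filter]
      refine ⟨he'.2.1, he'.2.2, le_rfl, h, (segHeight_right he'.2.2).le, ?_⟩
      rw [← segHeight_right (Y := Y) he'.2.2]
      exact segHeight_le_of_slope_le hef hs.le he'.2.2.le
    · refine ⟨f.2, ?_⟩
      rw [hW, Finset.mem_filter]
      refine ⟨hf'.2.1, hef ▸ hf'.2.2, h, le_rfl, ?_, (segHeight_right hf'.2.2).ge⟩
      rw [← segHeight_right (Y := Y) hf'.2.2]
      exact segHeight_le_of_slope_le hef hs.le (hef ▸ hf'.2.2.le)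
  obtain ⟨w, hw, hmin⟩ := W.exists_min_image X hne
  obtain ⟨h0, h1, h2, h3, h4, h5⟩ := Finset.mem_filter.1 hw
  refine ⟨w, he, hf, hef, hs, hn, h0, h1, h2, h3, h4, h5, fun v hv hv1 hv2 => ?_⟩
  by_contra! hcon
  have : v ∈ W := Finset.mem_filter.2 ⟨hv, hv1, by linarith, by linarith, hcon⟩
  have := hmin v this
  linarith

/-- Two wedges with a common apex that lies on the same side have a common source. -/
theorem IsWedgeApex.not_source_lt (hE : ∀ e ∈ E, e.1 ∈ P ∧ e.2 ∈ P ∧ X e.1 < X e.2)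
    (hc : ∀ e ∈ E, ∀ f ∈ E, e ≠ f → ¬ SegCross X Y e f)
    {e f e' f' : ι × ι} {w : ι} (h : IsWedgeApex X Y P E e f w) (h' : IsWedgeApex X Y P E e' f' w)
    (hside : (Y w < segHeight X Y f (X w) ∧ Y w < segHeight X Y f' (X w)) ∨
      (segHeight X Y e (X w) < Y w ∧ segHeight X Y e' (X w) < Y w)) :
    ¬ X e.1 < X e'.1 := by
  intro hlt
  have hne : e.1 ≠ e'.1 := fun h => by rw [h] at hlt; exact lt_irrefl _ hlt
  have hf1 := h.fst_eq
  have hf1' := h'.fst_eq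
  have hl := h'.left_lt
  -- The later source lies outside the first wedge. If it is below `e`, then `f'` stays below `e` up
  -- to `w`, which squeezes `w` onto both edges, against `hside`. The other case is symmetric, with
  -- `e'` above `f`.
  rcases h.first e'.1 (hE _ h'.memE).1 hlt hl with hv | hv
  · have hnc : ¬ SegCross X Y f' e :=
      hc _ h'.memF _ h.memE (fun h0 => hne (by rw [hf1', h0]))
    have := segHeight_le_of_not_cross hnc (x := X e'.1) (y := X w) (by rw [hf1']) hlt.le hl
      h'.le_f h.le_e (by rw [hf1', segHeight_left, ← hf1']; exact hv)
    have h1 := h.above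
    have h2 := h'.below
    rcases hside with hs | hs <;> linarith
  · have hnc : ¬ SegCross X Y f e' :=
      hc _ h.memF _ h'.memE (fun h0 => hne (by rw [hf1, h0]))
    have := segHeight_le_of_not_cross hnc (x := X e'.1) (y := X w) (by rw [← hf1]; exact hlt.le)
      le_rfl hl h.le_f h'.le_e (by rw [segHeight_left]; exact hv)
    have h1 := h.below
    have h2 := h'.above
    rcases hside with hs | hs <;> linarith

/-- Since `f` is the next edge above `e`, a steeper `e'` lies on or above `f`. The wedges then meet
only along `f` and `e'`, so `w` would lie on both edges, which `hside` forbids. -/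
theorem IsWedgeApex.not_slope_lt
    {e f e' f' : ι × ι} {w : ι} (h : IsWedgeApex X Y P E e f w) (h' : IsWedgeApex X Y P E e' f' w)
    (hside : (Y w < segHeight X Y f (X w) ∧ Y w < segHeight X Y f' (X w)) ∨
      (segHeight X Y e (X w) < Y w ∧ segHeight X Y e' (X w) < Y w))
    (h1 : e.1 = e'.1) : ¬ segSlope X Y e < segSlope X Y e' := by
  intro hlt
  have := h.next e' h'.memE h1.symm hlt
  have := segHeight_le_of_slope_le (h.fst_eq.symm.trans h1) this
    (x := X w) (by rw [← h.fst_eq]; exact h.left_lt.le)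
  have h2 := h.below
  have h3 := h'.above
  rcases hside with hs | hs <;> linarith

/-- Non-crossing segments from a common point have different slopes. -/
theorem segSlope_injOn (hE : ∀ e ∈ E, e.1 ∈ P ∧ e.2 ∈ P ∧ X e.1 < X e.2)
    (hc : ∀ e ∈ E, ∀ f ∈ E, e ≠ f → ¬ SegCross X Y e f)
    {e f : ι × ι} (he : e ∈ E) (hf : f ∈ E) (h : e.1 = f.1)
    (hs : segSlope X Y e = segSlope X Y f) : e = f := by
  by_contra hne
  refine hc e he f hf hne ?_
  have h1 := (hE e he).2.2
  have h2 := (hE f hf).2.2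
  obtain ⟨x, hx1, hx2⟩ := exists_between (lt_min h1 (h ▸ h2))
  rw [lt_min_iff] at hx2
  exact ⟨x, hx1, h ▸ hx1, hx2.1, hx2.2, by simp only [segHeight, hs, h]⟩

/-- The injectivity behind the charging: a point is charged at most once from each side. Symmetry in
the two wedges turns the exclusions above into equality of sources and then of slopes. -/
theorem IsWedgeApex.unique (hX : Set.InjOn X P)
    (hE : ∀ e ∈ E, e.1 ∈ P ∧ e.2 ∈ P ∧ X e.1 < X e.2)
    (hc : ∀ e ∈ E, ∀ f ∈ E, e ≠ f → ¬ SegCross X Y e f)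
    {e f e' f' : ι × ι} {w : ι} (h : IsWedgeApex X Y P E e f w) (h' : IsWedgeApex X Y P E e' f' w)
    (hside : (Y w < segHeight X Y f (X w) ∧ Y w < segHeight X Y f' (X w)) ∨
      (segHeight X Y e (X w) < Y w ∧ segHeight X Y e' (X w) < Y w)) : e = e' := by
  have hside' : (Y w < segHeight X Y f' (X w) ∧ Y w < segHeight X Y f (X w)) ∨
      (segHeight X Y e' (X w) < Y w ∧ segHeight X Y e (X w) < Y w) := by tauto
  have h1 : e.1 = e'.1 := hX (hE _ h.memE).1 (hE _ h'.memE).1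
    (le_antisymm (not_lt.1 (h'.not_source_lt hE hc h hside'))
      (not_lt.1 (h.not_source_lt hE hc h' hside)))
  exact segSlope_injOn hE hc h.memE h'.memE h1
    (le_antisymm (not_lt.1 (h'.not_slope_lt h hside' h1.symm))
      (not_lt.1 (h.not_slope_lt h' hside h1)))

/-- A non-crossing straight-line graph on `n` points has at most `3 n` edges. -/
theorem card_edges_le_of_noncrossing (hX : Set.InjOn X P)
    (hE : ∀ e ∈ E, e.1 ∈ P ∧ e.2 ∈ P ∧ X e.1 < X e.2)
    (hc : ∀ e ∈ E, ∀ f ∈ E, e ≠ f → ¬ SegCross X Y e f) :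
    E.card ≤ 3 * P.card := by
  classical
  -- The topmost edge at each source costs at most `n`; every other edge is the lower side of a
  -- wedge and is charged to the apex, costing at most `2 n`.
  set T := E.filter (fun e => ∀ g ∈ E, g.1 = e.1 → segSlope X Y g ≤ segSlope X Y e) with hT
  set N := E.filter (fun e => ¬ ∀ g ∈ E, g.1 = e.1 → segSlope X Y g ≤ segSlope X Y e) with hN
  have hcard : T.card + N.card = E.card := Finset.card_filter_add_card_filter_not _
  have hTc : T.card ≤ P.card := by
    refine Finset.card_le_card_of_injOn Prod.fst (fun e he => ?_) (fun e he f hf h => ?_)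
    · exact (hE e (Finset.mem_filter.1 he).1).1
    · obtain ⟨he1, he2⟩ := Finset.mem_filter.1 (Finset.mem_coe.1 he)
      obtain ⟨hf1, hf2⟩ := Finset.mem_filter.1 (Finset.mem_coe.1 hf)
      exact segSlope_injOn hE hc he1 hf1 h (le_antisymm (hf2 e he1 h) (he2 f hf1 h.symm))
  have hap : ∀ e : ι × ι, ∃ fw : (ι × ι) × ι, e ∈ N → IsWedgeApex X Y P E e fw.1 fw.2 := by
    intro e
    by_cases he : e ∈ N
    · obtain ⟨heE, hg⟩ := Finset.mem_filter.1 he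
      push Not at hg
      obtain ⟨g, hgE, hg1, hg2⟩ := hg
      obtain ⟨f, hf, hmin⟩ := (E.filter (fun g => g.1 = e.1 ∧
        segSlope X Y e < segSlope X Y g)).exists_min_image (segSlope X Y)
        ⟨g, Finset.mem_filter.2 ⟨hgE, hg1, hg2⟩⟩
      obtain ⟨hfE, hf1, hf2⟩ := Finset.mem_filter.1 hf
      obtain ⟨w, hw⟩ := exists_isWedgeApex hE heE hfE hf1.symm hf2
        (fun g h1 h2 h3 => hmin g (Finset.mem_filter.2 ⟨h1, h2, h3⟩))
      exact ⟨(f, w), fun _ => hw⟩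
    · exact ⟨(e, e.1), fun h => absurd h he⟩
  choose φ hφ using hap
  have hNc : N.card ≤ (P ×ˢ (Finset.univ : Finset Bool)).card := by
    -- The Boolean records whether the apex is strictly below the upper edge. If it is not, it is
    -- strictly above the lower edge, because the slopes differ.
    refine Finset.card_le_card_of_injOn
      (fun e => ((φ e).2, decide (Y (φ e).2 < segHeight X Y (φ e).1 (X (φ e).2))))
      (fun e he => ?_) (fun e he e' he' h => ?_)
    · exact Finset.mem_product.2 ⟨(hφ e he).mem, Finset.mem_univ _⟩
    · have h1 := hφ e he
      have h2 := hφ e' he'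
      simp only [Prod.mk.injEq, decide_eq_decide] at h
      obtain ⟨hw, hiff⟩ := h
      rw [← hw] at h2 hiff
      refine h1.unique hX hE hc h2 ?_
      by_cases hb : Y (φ e).2 < segHeight X Y (φ e).1 (X (φ e).2)
      · exact Or.inl ⟨hb, hiff.1 hb⟩
      · right
        have hb' := fun h => hb (hiff.2 h)
        have a1 := segHeight_lt_of_slope_lt h1.fst_eq h1.slope_lt h1.left_lt
        have a2 := segHeight_lt_of_slope_lt h2.fst_eq h2.slope_lt h2.left_lt
        exact ⟨a1.trans_le (not_lt.1 hb), a2.trans_le (not_lt.1 hb')⟩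
  rw [Finset.card_product, Finset.card_univ, Fintype.card_bool] at hNc
  omega

end Planar

/-! ### Random subsets, with expectations as weighted sums. -/

section Sampling

-- This is the probability that all of `A` survives when each point is kept independently with
-- probability `q`: factoring out `A` leaves a binomial sum equal to `(q + (1 - q)) ^ _ = 1`.
open Classical in
theorem sum_powerset_weight_superset {ι : Type*} {A P : Finset ι} (hA : A ⊆ P) (q : ℝ) :
    ∑ S ∈ P.powerset, (if A ⊆ S then q ^ S.card * (1 - q) ^ (P.card - S.card) else 0) =
      q ^ A.card := by
  rw [← Finset.sum_filter]
  have h1 : P.powerset.filter (fun S => A ⊆ S) = (P \ A).powerset.image (A ∪ ·) := by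
    rw [← Finset.Icc_eq_image_powerset hA]
    ext S
    simp [Finset.mem_Icc, and_comm]
  have hdisj : ∀ S ∈ (P \ A).powerset, Disjoint A S := fun S hS =>
    (Finset.disjoint_of_subset_left (Finset.mem_powerset.1 hS) Finset.sdiff_disjoint).symm
  rw [h1, Finset.sum_image]
  · have h2 : ∀ S ∈ (P \ A).powerset, q ^ (A ∪ S).card * (1 - q) ^ (P.card - (A ∪ S).card) =
        q ^ A.card * (q ^ S.card * (1 - q) ^ ((P \ A).card - S.card)) := by
      intro S hS
      rw [Finset.card_union_of_disjoint (hdisj S hS), Finset.card_sdiff_of_subset hA, pow_add,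
        Nat.sub_add_eq, mul_assoc]
    rw [Finset.sum_congr rfl h2, ← Finset.mul_sum, Finset.sum_pow_mul_eq_add_pow]
    simp
  · intro S hS S' hS' h
    have h1 := Finset.union_sdiff_cancel_left (hdisj S hS)
    have h2 := Finset.union_sdiff_cancel_left (hdisj S' hS')
    simp only at h
    rw [← h1, h, h2]

open Classical in
/-- The expected number of `j`-element patterns contained in a random subset. -/
theorem sum_powerset_weight_mul_card {ι κ : Type*} {P : Finset ι} (q : ℝ) (K : Finset κ)
    (g : κ → Finset ι) (j : ℕ) (hg : ∀ x ∈ K, g x ⊆ P ∧ (g x).card = j) :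
    ∑ S ∈ P.powerset, q ^ S.card * (1 - q) ^ (P.card - S.card) *
      ((K.filter (fun x => g x ⊆ S)).card : ℝ) = q ^ j * K.card := by
  have h1 : ∀ S ∈ P.powerset, q ^ S.card * (1 - q) ^ (P.card - S.card) *
      ((K.filter (fun x => g x ⊆ S)).card : ℝ) =
      ∑ x ∈ K, (if g x ⊆ S then q ^ S.card * (1 - q) ^ (P.card - S.card) else 0) := by
    intro S _
    rw [← Finset.sum_filter, Finset.sum_const, nsmul_eq_mul, mul_comm]
  rw [Finset.sum_congr rfl h1, Finset.sum_comm]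
  have h2 : ∀ x ∈ K, ∑ S ∈ P.powerset,
      (if g x ⊆ S then q ^ S.card * (1 - q) ^ (P.card - S.card) else 0) = q ^ j := by
    intro x hx
    rw [sum_powerset_weight_superset (hg x hx).1, (hg x hx).2]
  rw [Finset.sum_congr rfl h2, Finset.sum_const, nsmul_eq_mul, mul_comm]

end Sampling

/-! ### The crossing inequality. -/

section Crossing

variable {ι : Type*} {X Y : ι → ℝ} {P : Finset ι} {E : Finset (ι × ι)}

open Classical in
/-- The ordered pairs of crossing segments of `E`. -/
noncomputable def crossings (X Y : ι → ℝ) (E : Finset (ι × ι)) :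
    Finset ((ι × ι) × (ι × ι)) :=
  E.offDiag.filter (fun p => SegCross X Y p.1 p.2)

theorem mem_crossings {p : (ι × ι) × (ι × ι)} :
    p ∈ crossings X Y E ↔ p.1 ∈ E ∧ p.2 ∈ E ∧ p.1 ≠ p.2 ∧ SegCross X Y p.1 p.2 := by
  classical
  simp [crossings, Finset.mem_offDiag, and_assoc]

/-- Deleting one edge of a crossing pair loses one edge and at least one crossing; repeat until no
crossing is left. -/
theorem card_edges_le_add_crossings (hX : Set.InjOn X P)
    (hE : ∀ e ∈ E, e.1 ∈ P ∧ e.2 ∈ P ∧ X e.1 < X e.2) :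
    E.card ≤ 3 * P.card + (crossings X Y E).card := by
  classical
  induction E using Finset.strongInduction with
  | H E ih =>
    by_cases hc : ∀ e ∈ E, ∀ f ∈ E, e ≠ f → ¬ SegCross X Y e f
    · have := card_edges_le_of_noncrossing hX hE hc
      omega
    · push Not at hc
      obtain ⟨e, he, f, hf, hne, hcr⟩ := hc
      have h1 := ih (E.erase e) (Finset.erase_ssubset he)
        (fun g hg => hE g (Finset.mem_of_mem_erase hg))
      have h2 : (crossings X Y (E.erase e)).card < (crossings X Y E).card := by
        refine Finset.card_lt_card ((Finset.ssubset_iff_of_subset ?_).2 ⟨(e, f), ?_, ?_⟩)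
        · intro p hp
          rw [mem_crossings] at hp ⊢
          exact ⟨Finset.mem_of_mem_erase hp.1, Finset.mem_of_mem_erase hp.2.1, hp.2.2⟩
        · exact mem_crossings.2 ⟨he, hf, hne, hcr⟩
        · intro h
          exact Finset.notMem_erase e E (mem_crossings.1 h).1
      have h3 := Finset.card_erase_add_one he
      omega

/-- The crossing inequality for a random vertex subset of density `q`. -/
theorem sampled_crossing_inequality (hX : Set.InjOn X P)
    (hE : ∀ e ∈ E, e.1 ∈ P ∧ e.2 ∈ P ∧ X e.1 < X e.2)
    (hd : ∀ e ∈ E, ∀ f ∈ E, e ≠ f → SegCross X Y e f →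
      e.1 ≠ f.1 ∧ e.1 ≠ f.2 ∧ e.2 ≠ f.1 ∧ e.2 ≠ f.2)
    {q : ℝ} (hq0 : 0 ≤ q) (hq1 : q ≤ 1) :
    q ^ 2 * E.card ≤ 3 * (q * P.card) + q ^ 4 * (crossings X Y E).card := by
  classical
  have hne : ∀ e ∈ E, e.1 ≠ e.2 := fun e he h => by
    have := (hE e he).2.2
    rw [h] at this
    exact lt_irrefl _ this
  have h1 := sum_powerset_weight_mul_card (P := P) q E (fun e => {e.1, e.2}) 2 (fun e he => by
    refine ⟨?_, Finset.card_pair (hne e he)⟩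
    intro x hx
    rcases Finset.mem_insert.1 hx with rfl | hx
    · exact (hE e he).1
    · rw [Finset.mem_singleton.1 hx]; exact (hE e he).2.1)
  have h2 := sum_powerset_weight_mul_card (P := P) q P (fun x => {x}) 1 (fun x hx =>
    ⟨by simpa using hx, Finset.card_singleton x⟩)
  have h3 := sum_powerset_weight_mul_card (P := P) q (crossings X Y E)
    (fun p => {p.1.1, p.1.2, p.2.1, p.2.2}) 4 (fun p hp => by
      obtain ⟨he, hf, hef, hcr⟩ := mem_crossings.1 hp
      obtain ⟨d1, d2, d3, d4⟩ := hd _ he _ hf hef hcr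
      constructor
      · intro x hx
        simp only [Finset.mem_insert, Finset.mem_singleton] at hx
        rcases hx with rfl | rfl | rfl | rfl
        exacts [(hE _ he).1, (hE _ he).2.1, (hE _ hf).1, (hE _ hf).2.1]
      · rw [Finset.card_insert_of_notMem, Finset.card_insert_of_notMem, Finset.card_pair (hne _ hf)]
        · simp [d3, d4]
        · simp [d1, d2, hne _ he])
  -- An edge survives with probability `q ^ 2`, a vertex with `q`, and a crossing with `q ^ 4`, as
  -- `hd` makes its four endpoints distinct. All three terms become averages over `S`, compared
  -- subset by subset.
  rw [← h1, ← h3, ← pow_one q, ← h2, pow_one, Finset.mul_sum, ← Finset.sum_add_distrib]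
  refine Finset.sum_le_sum fun S hS => ?_
  have hS' := Finset.mem_powerset.1 hS
  have hw : 0 ≤ q ^ S.card * (1 - q) ^ (P.card - S.card) :=
    mul_nonneg (pow_nonneg hq0 _) (pow_nonneg (by linarith) _)
  have key := card_edges_le_add_crossings (X := X) (Y := Y) (P := S)
    (E := E.filter (fun e => ({e.1, e.2} : Finset ι) ⊆ S)) (hX.mono (by exact_mod_cast hS'))
    (fun e he => by
      obtain ⟨he1, he2⟩ := Finset.mem_filter.1 he
      exact ⟨he2 (by simp), he2 (by simp), (hE e he1).2.2⟩)
  have e1 : P.filter (fun x => ({x} : Finset ι) ⊆ S) = S := by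
    ext x
    simpa using fun hx => hS' hx
  have e2 : (crossings X Y (E.filter (fun e => ({e.1, e.2} : Finset ι) ⊆ S))).card ≤
      ((crossings X Y E).filter
        (fun p => ({p.1.1, p.1.2, p.2.1, p.2.2} : Finset ι) ⊆ S)).card := by
    refine Finset.card_le_card fun p hp => ?_
    obtain ⟨he, hf, hr⟩ := mem_crossings.1 hp
    rw [Finset.mem_filter] at he hf
    refine Finset.mem_filter.2 ⟨mem_crossings.2 ⟨he.1, hf.1, hr⟩, fun x hx => ?_⟩
    simp only [Finset.mem_insert, Finset.mem_singleton] at hx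
    rcases hx with rfl | rfl | rfl | rfl
    exacts [he.2 (by simp), he.2 (by simp), hf.2 (by simp), hf.2 (by simp)]
  rw [e1]
  have key' : ((E.filter (fun e => ({e.1, e.2} : Finset ι) ⊆ S)).card : ℝ) ≤ 3 * S.card +
      ((crossings X Y E).filter
        (fun p => ({p.1.1, p.1.2, p.2.1, p.2.2} : Finset ι) ⊆ S)).card := by
    exact_mod_cast key.trans (by omega)
  have := mul_le_mul_of_nonneg_left key' hw
  linarith

end Crossing

/-! ### Szemerédi–Trotter for non-vertical lines. -/

section Incidences

variable {ι : Type*} {X Y : ι → ℝ} {P : Finset ι}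

open Classical in
/-- The points of `P` on the line `y = l.1 * x + l.2`. -/
noncomputable def trace (X Y : ι → ℝ) (P : Finset ι) (l : ℝ × ℝ) : Finset ι :=
  P.filter (fun p => Y p = l.1 * X p + l.2)

theorem mem_trace {l : ℝ × ℝ} {p : ι} : p ∈ trace X Y P l ↔ p ∈ P ∧ Y p = l.1 * X p + l.2 := by
  classical
  simp [trace]

open Classical in
/-- The pairs of consecutive points of `P` on a line. -/
noncomputable def consecutive (X Y : ι → ℝ) (P : Finset ι) (l : ℝ × ℝ) : Finset (ι × ι) :=
  (trace X Y P l ×ˢ trace X Y P l).filter (fun e => X e.1 < X e.2 ∧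
    ∀ c ∈ trace X Y P l, X c ≤ X e.1 ∨ X e.2 ≤ X c)

theorem mem_consecutive {l : ℝ × ℝ} {e : ι × ι} : e ∈ consecutive X Y P l ↔
    e.1 ∈ trace X Y P l ∧ e.2 ∈ trace X Y P l ∧ X e.1 < X e.2 ∧
      ∀ c ∈ trace X Y P l, X c ≤ X e.1 ∨ X e.2 ≤ X c := by
  classical
  simp [consecutive, and_assoc]

/-- Every point of the line except the rightmost has a successor. -/
theorem card_trace_le_card_consecutive_add_one (hX : Set.InjOn X P) (l : ℝ × ℝ) :
    (trace X Y P l).card ≤ (consecutive X Y P l).card + 1 := by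
  classical
  rcases (trace X Y P l).eq_empty_or_nonempty with h | hne
  · simp [h]
  obtain ⟨z, hz, hmax⟩ := (trace X Y P l).exists_max_image X hne
  have hnext : ∀ a, ∃ b, a ∈ (trace X Y P l).erase z → (a, b) ∈ consecutive X Y P l := by
    intro a
    by_cases ha : a ∈ (trace X Y P l).erase z
    · obtain ⟨haz, ha⟩ := Finset.mem_erase.1 ha
      have hlt : X a < X z := lt_of_le_of_ne (hmax a ha)
        (fun h => haz (hX (mem_trace.1 ha).1 (mem_trace.1 hz).1 h))
      obtain ⟨b, hb, hmin⟩ := ((trace X Y P l).filter (fun b => X a < X b)).exists_min_image X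
        ⟨z, Finset.mem_filter.2 ⟨hz, hlt⟩⟩
      obtain ⟨hb1, hb2⟩ := Finset.mem_filter.1 hb
      refine ⟨b, fun _ => mem_consecutive.2 ⟨ha, hb1, hb2, fun c hc => ?_⟩⟩
      rcases le_or_gt (X c) (X a) with h | h
      · exact Or.inl h
      · exact Or.inr (hmin c (Finset.mem_filter.2 ⟨hc, h⟩))
    · exact ⟨a, fun h => absurd h ha⟩
  choose φ hφ using hnext
  have h1 : ((trace X Y P l).erase z).card ≤ (consecutive X Y P l).card :=
    Finset.card_le_card_of_injOn (fun a => (a, φ a)) (fun a ha => hφ a ha)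
      (fun a _ b _ h => (Prod.mk.inj h).1)
  have := Finset.card_erase_add_one hz
  omega

theorem segSlope_of_mem_trace {l : ℝ × ℝ} {e : ι × ι} (h1 : e.1 ∈ trace X Y P l)
    (h2 : e.2 ∈ trace X Y P l) (hlt : X e.1 < X e.2) : segSlope X Y e = l.1 := by
  have h1 := (mem_trace.1 h1).2
  have h2 := (mem_trace.1 h2).2
  have : X e.2 - X e.1 ≠ 0 := by linarith
  rw [segSlope, div_eq_iff this]
  linarith

theorem segHeight_of_mem_trace {l : ℝ × ℝ} {e : ι × ι} (h1 : e.1 ∈ trace X Y P l)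
    (h2 : e.2 ∈ trace X Y P l) (hlt : X e.1 < X e.2) (x : ℝ) :
    segHeight X Y e x = l.1 * x + l.2 := by
  rw [segHeight, segSlope_of_mem_trace h1 h2 hlt, (mem_trace.1 h1).2]
  ring

theorem eq_of_two_points {l l' : ℝ × ℝ} {x y : ℝ} (hxy : x ≠ y)
    (h1 : l.1 * x + l.2 = l'.1 * x + l'.2) (h2 : l.1 * y + l.2 = l'.1 * y + l'.2) : l = l' := by
  have h3 : (l.1 - l'.1) * (x - y) = 0 := by linear_combination h1 - h2
  have h4 : l.1 = l'.1 := by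
    rcases mul_eq_zero.1 h3 with h | h
    · linarith
    · exact absurd (sub_eq_zero.1 h) hxy
  refine Prod.ext h4 ?_
  rw [h4] at h1
  linarith

theorem line_eq_of_mem_trace {l l' : ℝ × ℝ} {a b : ι} (hab : X a ≠ X b)
    (ha : a ∈ trace X Y P l) (hb : b ∈ trace X Y P l)
    (ha' : a ∈ trace X Y P l') (hb' : b ∈ trace X Y P l') : l = l' :=
  eq_of_two_points hab ((mem_trace.1 ha).2.symm.trans (mem_trace.1 ha').2)
    ((mem_trace.1 hb).2.symm.trans (mem_trace.1 hb').2)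

/-- Consecutive pairs on a line have disjoint interiors. -/
theorem consecutive_eq (hX : Set.InjOn X P) {l : ℝ × ℝ} {e f : ι × ι} {x : ℝ}
    (he : e ∈ consecutive X Y P l) (hf : f ∈ consecutive X Y P l)
    (h1 : X e.1 < x) (h2 : x < X e.2) (h3 : X f.1 < x) (h4 : x < X f.2) : e = f := by
  rw [mem_consecutive] at he hf
  obtain ⟨e1, e2, -, e4⟩ := he
  obtain ⟨f1, f2, -, f4⟩ := hf
  have a1 := (e4 _ f1).resolve_right (by linarith)
  have a2 := (f4 _ e1).resolve_right (by linarith)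
  have a3 := (e4 _ f2).resolve_left (by linarith)
  have a4 := (f4 _ e2).resolve_left (by linarith)
  exact Prod.ext (hX (mem_trace.1 e1).1 (mem_trace.1 f1).1 (le_antisymm a2 a1))
    (hX (mem_trace.1 e2).1 (mem_trace.1 f2).1 (le_antisymm a3 a4))

/-- The Szemerédi–Trotter bound on the number of lines with at least `k` points. -/
theorem szemeredi_trotter (hX : Set.InjOn X P) (ℒ : Finset (ℝ × ℝ)) {k : ℕ} (hk : 2 ≤ k)
    (hℒ : ∀ l ∈ ℒ, k ≤ (trace X Y P l).card) :
    (ℒ.card : ℝ) * (k - 1) ≤ 6 * P.card ∨ (ℒ.card : ℝ) * (k - 1) ^ 3 ≤ 72 * (P.card : ℝ) ^ 2 := by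
  classical
  set E := ℒ.biUnion (consecutive X Y P) with hEdef
  have memE : ∀ {e}, e ∈ E → ∃ l ∈ ℒ, e ∈ consecutive X Y P l := fun he => by
    simpa [hEdef] using he
  have hE : ∀ e ∈ E, e.1 ∈ P ∧ e.2 ∈ P ∧ X e.1 < X e.2 := by
    intro e he
    obtain ⟨l, hl, he⟩ := memE he
    obtain ⟨h1, h2, h3, -⟩ := mem_consecutive.1 he
    exact ⟨(mem_trace.1 h1).1, (mem_trace.1 h2).1, h3⟩
  have hdisj : ∀ l ∈ ℒ, ∀ l' ∈ ℒ, l ≠ l' →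
      Disjoint (consecutive X Y P l) (consecutive X Y P l') := by
    intro l _ l' _ hne
    refine Finset.disjoint_left.2 fun e he he' => hne ?_
    obtain ⟨h1, h2, h3, -⟩ := mem_consecutive.1 he
    obtain ⟨h1', h2', -, -⟩ := mem_consecutive.1 he'
    exact line_eq_of_mem_trace h3.ne h1 h2 h1' h2'
  have hEcard : ℒ.card * (k - 1) ≤ E.card := by
    rw [hEdef, Finset.card_biUnion hdisj]
    refine Finset.card_nsmul_le_sum ℒ _ (k - 1) fun l hl => ?_
    have h1 := card_trace_le_card_consecutive_add_one (Y := Y) hX l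
    have h2 := hℒ l hl
    omega
  have hlines : ∀ e ∈ E, ∀ f ∈ E, e ≠ f → SegCross X Y e f →
      ∀ l l', e ∈ consecutive X Y P l → f ∈ consecutive X Y P l' → l ≠ l' := by
    rintro e - f - hne ⟨x, x1, x2, x3, x4, -⟩ l l' he hf rfl
    exact hne (consecutive_eq hX he hf x1 x3 x2 x4)
  have hd : ∀ e ∈ E, ∀ f ∈ E, e ≠ f → SegCross X Y e f →
      e.1 ≠ f.1 ∧ e.1 ≠ f.2 ∧ e.2 ≠ f.1 ∧ e.2 ≠ f.2 := by
    intro e he f hf hne hcr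
    obtain ⟨l, hl, hel⟩ := memE he
    obtain ⟨l', hl', hfl⟩ := memE hf
    have hll := hlines e he f hf hne hcr l l' hel hfl
    obtain ⟨x, x1, x2, x3, x4, x5⟩ := hcr
    obtain ⟨e1, e2, e3, -⟩ := mem_consecutive.1 hel
    obtain ⟨f1, f2, f3, -⟩ := mem_consecutive.1 hfl
    rw [segHeight_of_mem_trace e1 e2 e3, segHeight_of_mem_trace f1 f2 f3] at x5
    have key : ∀ a, a ∈ trace X Y P l → a ∈ trace X Y P l' → X a = x := by
      intro a ha ha'
      by_contra hax
      exact hll (eq_of_two_points hax ((mem_trace.1 ha).2.symm.trans (mem_trace.1 ha').2) x5)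
    refine ⟨fun h => ?_, fun h => ?_, fun h => ?_, fun h => ?_⟩
    · exact x1.ne (key _ e1 (h ▸ f1))
    · exact x1.ne (key _ e1 (h ▸ f2))
    · exact x3.ne' (key _ e2 (h ▸ f1))
    · exact x3.ne' (key _ e2 (h ▸ f2))
  -- Two distinct lines meet at most once, and on each line that point is interior to at most one
  -- consecutive segment. So an ordered crossing pair is determined by its pair of lines.
  have hcross : (crossings X Y E).card ≤ ℒ.card * ℒ.card := by
    have hl : ∀ e : ι × ι, ∃ l : ℝ × ℝ, e ∈ E → l ∈ ℒ ∧ e ∈ consecutive X Y P l := by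
      intro e
      by_cases he : e ∈ E
      · obtain ⟨l, h⟩ := memE he
        exact ⟨l, fun _ => h⟩
      · exact ⟨0, fun h => absurd h he⟩
    choose φ hφ using hl
    rw [← Finset.card_product]
    refine Finset.card_le_card_of_injOn (fun p => (φ p.1, φ p.2)) (fun p hp => ?_)
      (fun p hp p' hp' h => ?_)
    · obtain ⟨he, hf, -⟩ := mem_crossings.1 hp
      exact Finset.mem_product.2 ⟨(hφ _ he).1, (hφ _ hf).1⟩
    · obtain ⟨he, hf, hne, hcr⟩ := mem_crossings.1 hp
      obtain ⟨he', hf', hne', hcr'⟩ := mem_crossings.1 hp'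
      have hll := hlines _ he _ hf hne hcr _ _ (hφ _ he).2 (hφ _ hf).2
      obtain ⟨h1, h2⟩ := Prod.mk.inj h
      have c1 := (hφ _ he).2
      have c2 := (hφ _ hf).2
      have c1' := (hφ _ he').2
      have c2' := (hφ _ hf').2
      rw [← h1] at c1'
      rw [← h2] at c2'
      obtain ⟨x, x1, x2, x3, x4, x5⟩ := hcr
      obtain ⟨y, y1, y2, y3, y4, y5⟩ := hcr'
      have d1 := mem_consecutive.1 c1
      have d2 := mem_consecutive.1 c2
      have d1' := mem_consecutive.1 c1'
      have d2' := mem_consecutive.1 c2'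
      rw [segHeight_of_mem_trace d1.1 d1.2.1 d1.2.2.1,
        segHeight_of_mem_trace d2.1 d2.2.1 d2.2.2.1] at x5
      rw [segHeight_of_mem_trace d1'.1 d1'.2.1 d1'.2.2.1,
        segHeight_of_mem_trace d2'.1 d2'.2.1 d2'.2.2.1] at y5
      have hxy : x = y := by
        by_contra hxy
        exact hll (eq_of_two_points hxy x5 y5)
      subst hxy
      exact Prod.ext (consecutive_eq hX c1 c1' x1 x3 y1 y3)
        (consecutive_eq hX c2 c2' x2 x4 y2 y4)
  rcases ℒ.eq_empty_or_nonempty with hemp | ⟨l₀, hl₀⟩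
  · left
    simp [hemp]
  have hn : (0 : ℝ) < P.card := by
    have h1 := hℒ l₀ hl₀
    have h2 : (trace X Y P l₀).card ≤ P.card := Finset.card_le_card (fun p hp => (mem_trace.1 hp).1)
    exact_mod_cast (by omega : 0 < P.card)
  have hm : (0 : ℝ) < ℒ.card := by exact_mod_cast Finset.card_pos.2 ⟨l₀, hl₀⟩
  have hr : (0 : ℝ) < (k : ℝ) - 1 := by
    have : (2 : ℝ) ≤ k := by exact_mod_cast hk
    linarith
  rw [or_iff_not_imp_left, not_le]
  intro hbig
  have hEr : (ℒ.card : ℝ) * (k - 1) ≤ E.card := by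
    have : ((ℒ.card * (k - 1) : ℕ) : ℝ) ≤ E.card := by exact_mod_cast hEcard
    rwa [Nat.cast_mul, Nat.cast_sub (by omega), Nat.cast_one] at this
  have hcr : ((crossings X Y E).card : ℝ) ≤ (ℒ.card : ℝ) * ℒ.card := by exact_mod_cast hcross
  set n : ℝ := (P.card : ℝ)
  set m : ℝ := (ℒ.card : ℝ)
  set r : ℝ := (k : ℝ) - 1
  have hmr : 0 < m * r := mul_pos hm hr
  -- With this `q` the edge term is at least twice the vertex term, so the crossing term must supply
  -- the rest: `3 n ≤ q ^ 3 m ^ 2`. The requirement `q ≤ 1` is the negated first alternative.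
  set q : ℝ := 6 * n / (m * r) with hq
  have hq0 : 0 < q := by positivity
  have hq1 : q ≤ 1 := (div_le_one hmr).2 hbig.le
  have hqe : q * (m * r) = 6 * n := div_mul_cancel₀ _ hmr.ne'
  have main := sampled_crossing_inequality (Y := Y) hX hE hd hq0.le hq1
  have h1 : q ^ 2 * (m * r) ≤ 3 * (q * n) + q ^ 4 * (m * m) :=
    (mul_le_mul_of_nonneg_left hEr (by positivity)).trans
      (main.trans (by
        have := mul_le_mul_of_nonneg_left hcr (by positivity : 0 ≤ q ^ 4)
        linarith))
  have h2 : q * (3 * n) ≤ q * (q ^ 3 * (m * m)) := by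
    have : q ^ 2 * (m * r) = q * (6 * n) := by rw [← hqe]; ring
    nlinarith
  have h3 := le_of_mul_le_mul_left h2 hq0
  have h4 : 3 * n * (m * r ^ 3) ≤ 3 * n * (72 * n ^ 2) := by
    calc 3 * n * (m * r ^ 3) ≤ q ^ 3 * (m * m) * (m * r ^ 3) :=
          mul_le_mul_of_nonneg_right h3 (by positivity)
      _ = (q * (m * r)) ^ 3 := by ring
      _ = 3 * n * (72 * n ^ 2) := by rw [hqe]; ring
  exact le_of_mul_le_mul_left h4 (by positivity)

end Incidences

/-! ### Summing over richness levels. -/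

section RichLines

variable {ι : Type*} {X Y : ι → ℝ} {P : Finset ι}

/-- Adds the two alternatives, using `k - 1 ≥ k / 2`; hence the constants `6 * 2` and `72 * 2 ^ 3`.
-/
theorem card_rich_lines_le (hX : Set.InjOn X P) (ℒ : Finset (ℝ × ℝ)) {k : ℕ} (hk : 2 ≤ k)
    (hℒ : ∀ l ∈ ℒ, k ≤ (trace X Y P l).card) :
    (ℒ.card : ℝ) ≤ 12 * P.card / k + 576 * (P.card : ℝ) ^ 2 / k ^ 3 := by
  have hk2 : (2 : ℝ) ≤ k := by exact_mod_cast hk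
  have hk0 : (0 : ℝ) < k := by linarith
  have hn : (0 : ℝ) ≤ P.card := Nat.cast_nonneg _
  have hm : (0 : ℝ) ≤ ℒ.card := Nat.cast_nonneg _
  have hr : (k : ℝ) / 2 ≤ k - 1 := by linarith
  rcases szemeredi_trotter hX ℒ hk hℒ with h | h
  · have h1 : (ℒ.card : ℝ) * (k / 2) ≤ 6 * P.card :=
      (mul_le_mul_of_nonneg_left hr hm).trans h
    have h2 : (ℒ.card : ℝ) ≤ 12 * P.card / k := by
      rw [le_div_iff₀ hk0]
      linarith
    have : 0 ≤ 576 * (P.card : ℝ) ^ 2 / k ^ 3 := by positivity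
    linarith
  · have h1 : (ℒ.card : ℝ) * (k / 2) ^ 3 ≤ 72 * (P.card : ℝ) ^ 2 :=
      (mul_le_mul_of_nonneg_left (pow_le_pow_left₀ (by linarith) hr 3) hm).trans h
    have h2 : (ℒ.card : ℝ) ≤ 576 * (P.card : ℝ) ^ 2 / k ^ 3 := by
      rw [le_div_iff₀ (by positivity)]
      have : (ℒ.card : ℝ) * (k / 2) ^ 3 = ℒ.card * k ^ 3 / 8 := by ring
      linarith
    have : 0 ≤ 12 * (P.card : ℝ) / k := by positivity
    linarith

/-- Layer-cake form of the square. The common range up to `K` lets the sum over lines be exchanged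
with the sum over levels. -/
theorem sq_le_sum_Ioc {r K : ℕ} (h : r ≤ K) :
    (r : ℝ) ^ 2 ≤ ∑ k ∈ Finset.Ioc 0 K, if k ≤ r then 2 * (k : ℝ) else 0 := by
  have h1 : ∀ r : ℕ, ∑ k ∈ Finset.Ioc 0 r, 2 * (k : ℝ) = (r : ℝ) * (r + 1) := by
    intro r
    induction r with
    | zero => simp
    | succ r ih =>
      rw [Finset.sum_Ioc_succ_top (Nat.zero_le r), ih]
      push_cast
      ring
  have h2 : (Finset.Ioc 0 K).filter (fun k => k ≤ r) = Finset.Ioc 0 r := by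
    ext k
    simp only [Finset.mem_filter, Finset.mem_Ioc]
    omega
  rw [← Finset.sum_filter, h2, h1]
  have : (0 : ℝ) ≤ r := Nat.cast_nonneg _
  nlinarith

/-- Lines with between `c` and `K` points contain few pairs of points. -/
theorem sum_sq_card_trace_le (hX : Set.InjOn X P) (ℒ : Finset (ℝ × ℝ)) {c K : ℕ} (hc : 2 ≤ c)
    (hℒ : ∀ l ∈ ℒ, c ≤ (trace X Y P l).card ∧ (trace X Y P l).card ≤ K) :
    ∑ l ∈ ℒ, ((trace X Y P l).card : ℝ) ^ 2 ≤
      48 * P.card * K + 2304 * (P.card : ℝ) ^ 2 / c := by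
  classical
  set n : ℝ := (P.card : ℝ) with hn
  have hn0 : 0 ≤ n := Nat.cast_nonneg _
  have hc0 : (0 : ℝ) < c := by exact_mod_cast (by omega : 0 < c)
  rcases ℒ.eq_empty_or_nonempty with hemp | ⟨l₀, hl₀⟩
  · rw [hemp, Finset.sum_empty]
    positivity
  have hcK : c ≤ K := (hℒ l₀ hl₀).1.trans (hℒ l₀ hl₀).2
  have hcK' : (c : ℝ) ≤ K := by exact_mod_cast hcK
  set M : ℕ → ℝ := fun k => ((ℒ.filter (fun l => k ≤ (trace X Y P l).card)).card : ℝ) with hM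
  have hMk : ∀ k, 2 ≤ k → M k ≤ 12 * n / k + 576 * n ^ 2 / k ^ 3 := fun k hk =>
    card_rich_lines_le hX _ hk (fun l hl => (Finset.mem_filter.1 hl).2)
  have hMall : ∀ k, M k ≤ 12 * n / c + 576 * n ^ 2 / c ^ 3 := fun k =>
    le_trans (Nat.cast_le.2 (Finset.card_filter_le _ _))
      (card_rich_lines_le hX ℒ hc (fun l hl => (hℒ l hl).1))
  have h1 : ∑ l ∈ ℒ, ((trace X Y P l).card : ℝ) ^ 2 ≤ ∑ k ∈ Finset.Ioc 0 K, 2 * (k : ℝ) * M k := by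
    refine (Finset.sum_le_sum fun l hl => sq_le_sum_Ioc (hℒ l hl).2).trans (le_of_eq ?_)
    rw [Finset.sum_comm]
    refine Finset.sum_congr rfl fun k _ => ?_
    rw [← Finset.sum_filter, Finset.sum_const, nsmul_eq_mul, mul_comm]
  -- At levels up to `c` the bound for richness `c` applies, since no line of `ℒ` is poorer. Above
  -- `c`, the bound at each level leaves `∑ 1 / k ^ 2`, which is at most `1 / c`.
  have h2 : ∑ k ∈ Finset.Ioc 0 c, 2 * (k : ℝ) * M k ≤ 24 * n * c + 1152 * n ^ 2 / c := by
    have : ∀ k ∈ Finset.Ioc 0 c, 2 * (k : ℝ) * M k ≤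
        2 * c * (12 * n / c + 576 * n ^ 2 / c ^ 3) := by
      intro k hk
      have hkc : (k : ℝ) ≤ c := by exact_mod_cast (Finset.mem_Ioc.1 hk).2
      have hM0 : 0 ≤ M k := Nat.cast_nonneg _
      exact mul_le_mul (by linarith) (hMall k) hM0 (by positivity)
    refine (Finset.sum_le_sum this).trans (le_of_eq ?_)
    rw [Finset.sum_const, Nat.card_Ioc, nsmul_eq_mul]
    rw [Nat.sub_zero]
    field_simp
    ring
  have h3 : ∑ k ∈ Finset.Ioc c K, 2 * (k : ℝ) * M k ≤ 24 * n * K + 1152 * n ^ 2 / c := by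
    have : ∀ k ∈ Finset.Ioc c K, 2 * (k : ℝ) * M k ≤
        24 * n + 1152 * n ^ 2 * ((k : ℝ) ^ 2)⁻¹ := by
      intro k hk
      have hk2 : 2 ≤ k := by have := (Finset.mem_Ioc.1 hk).1; omega
      have hk0 : (0 : ℝ) < k := by exact_mod_cast (by omega : 0 < k)
      refine (mul_le_mul_of_nonneg_left (hMk k hk2) (by positivity)).trans (le_of_eq ?_)
      field_simp
      ring
    refine (Finset.sum_le_sum this).trans ?_
    rw [Finset.sum_add_distrib, Finset.sum_const, ← Finset.mul_sum, Nat.card_Ioc, nsmul_eq_mul]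
    have h4 := sum_Ioc_inv_sq_le_sub (α := ℝ) (k := c) (n := K) (by omega) hcK
    have h5 : (0 : ℝ) ≤ (K : ℝ)⁻¹ := by positivity
    have h6 : ((K - c : ℕ) : ℝ) ≤ K := by exact_mod_cast Nat.sub_le _ _
    have h7 : 1152 * n ^ 2 * ∑ k ∈ Finset.Ioc c K, ((k : ℝ) ^ 2)⁻¹ ≤ 1152 * n ^ 2 * (c : ℝ)⁻¹ :=
      mul_le_mul_of_nonneg_left (by linarith) (by positivity)
    have h8 : ((K - c : ℕ) : ℝ) * (24 * n) ≤ K * (24 * n) :=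
      mul_le_mul_of_nonneg_right h6 (by positivity)
    rw [div_eq_mul_inv]
    linarith
  have h4 : ∑ k ∈ Finset.Ioc 0 K, 2 * (k : ℝ) * M k =
      ∑ k ∈ Finset.Ioc 0 c, 2 * (k : ℝ) * M k + ∑ k ∈ Finset.Ioc c K, 2 * (k : ℝ) * M k :=
    (Finset.sum_Ioc_consecutive _ (Nat.zero_le c) hcK).symm
  have h5 : 24 * n * c ≤ 24 * n * K := mul_le_mul_of_nonneg_left hcK' (by positivity)
  have h6 : 2304 * n ^ 2 / (c : ℝ) = 1152 * n ^ 2 / c + 1152 * n ^ 2 / c := by ring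
  linarith

end RichLines

/-! ### Lines via the cross product, and Sylvester–Gallai. -/

section PlaneGeometry

/-- Twice the signed area of the triangle `a b c`. -/
def cross (a b c : Plane) : ℝ :=
  (b 0 - a 0) * (c 1 - a 1) - (b 1 - a 1) * (c 0 - a 0)

open Classical in
/-- The points of `P` on the line through `a` and `b`. -/
noncomputable def linePoints (P : Finset Plane) (a b : Plane) : Finset Plane :=
  P.filter (fun p => cross a b p = 0)

theorem mem_linePoints {P : Finset Plane} {a b p : Plane} :
    p ∈ linePoints P a b ↔ p ∈ P ∧ cross a b p = 0 := by
  classical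
  simp [linePoints]

theorem plane_ext {a b : Plane} (h0 : a 0 = b 0) (h1 : a 1 = b 1) : a = b := by
  ext i
  fin_cases i
  exacts [h0, h1]

theorem cross_self_left (a b : Plane) : cross a a b = 0 := by simp [cross]

theorem cross_self_right (a b : Plane) : cross a b b = 0 := by simp only [cross]; ring

theorem cross_self_outer (a b : Plane) : cross a b a = 0 := by simp [cross]

theorem cross_swap (a b c : Plane) : cross b a c = - cross a b c := by simp only [cross]; ring

theorem cross_swap_right (a b c : Plane) : cross a c b = - cross a b c := by
  simp only [cross]; ring

theorem linePoints_comm (P : Finset Plane) (a b : Plane) : linePoints P a b = linePoints P b a := by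
  ext p
  rw [mem_linePoints, mem_linePoints, cross_swap b a p, neg_eq_zero]

theorem exists_param_of_cross_eq_zero {a b p : Plane} (hab : a ≠ b) (h : cross a b p = 0) :
    ∃ t : ℝ, p 0 = a 0 + t * (b 0 - a 0) ∧ p 1 = a 1 + t * (b 1 - a 1) := by
  simp only [cross] at h
  by_cases h0 : b 0 - a 0 = 0
  · have h1 : b 1 - a 1 ≠ 0 := fun h1 => hab (plane_ext (by linarith) (by linarith))
    refine ⟨(p 1 - a 1) / (b 1 - a 1), ?_, ?_⟩
    · rw [h0] at h ⊢
      have : p 0 - a 0 = 0 := by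
        rcases mul_eq_zero.1 (show (b 1 - a 1) * (p 0 - a 0) = 0 by linarith) with h | h
        · exact absurd h h1
        · exact h
      linarith
    · field_simp
      ring
  · refine ⟨(p 0 - a 0) / (b 0 - a 0), ?_, ?_⟩
    · field_simp
      ring
    · field_simp
      linarith

theorem mem_line_iff_cross {a b p : Plane} (hab : a ≠ b) :
    p ∈ line[ℝ, a, b] ↔ cross a b p = 0 := by
  rw [mem_affineSpan_pair_iff_exists_lineMap_eq]
  constructor
  · rintro ⟨t, rfl⟩
    simp [cross, AffineMap.lineMap_apply]
    ring
  · intro h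
    obtain ⟨t, h0, h1⟩ := exists_param_of_cross_eq_zero hab h
    refine ⟨t, plane_ext ?_ ?_⟩
    · simp [AffineMap.lineMap_apply, h0]; ring
    · simp [AffineMap.lineMap_apply, h1]; ring

theorem cross_eq_zero_of_two {a b q r p : Plane} (hqr : q ≠ r) (hq : cross a b q = 0)
    (hr : cross a b r = 0) (hp : cross q r p = 0) : cross a b p = 0 := by
  obtain ⟨t, h0, h1⟩ := exists_param_of_cross_eq_zero hqr hp
  have : cross a b p = (1 - t) * cross a b q + t * cross a b r := by
    simp only [cross, h0, h1]; ring
  rw [this, hq, hr]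
  ring

/-- Two points on a line determine it. -/
theorem cross_eq_zero_iff_of_two {a b q r : Plane} (hab : a ≠ b) (hqr : q ≠ r)
    (hq : cross a b q = 0) (hr : cross a b r = 0) (p : Plane) :
    cross q r p = 0 ↔ cross a b p = 0 := by
  refine ⟨cross_eq_zero_of_two hqr hq hr, fun h => ?_⟩
  obtain ⟨s, q0, q1⟩ := exists_param_of_cross_eq_zero hab hq
  obtain ⟨t, r0, r1⟩ := exists_param_of_cross_eq_zero hab hr
  have : cross q r p = (t - s) * cross a b p := by simp only [cross, q0, q1, r0, r1]; ring
  rw [this, h, mul_zero]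

theorem not_collinear_of_cross_ne_zero {a b c : Plane} (h : cross a b c ≠ 0) :
    ¬ Collinear ℝ ({a, b, c} : Set Plane) := by
  intro hc
  have hab : a ≠ b := by rintro rfl; exact h (cross_self_left _ _)
  exact h ((mem_line_iff_cross hab).1
    (hc.mem_affineSpan_of_mem_of_ne (by simp) (by simp) (by simp) hab))

theorem ncard_inter_line {P : Finset Plane} {a b : Plane} (hab : a ≠ b) :
    ((P : Set Plane) ∩ (line[ℝ, a, b] : Set Plane)).ncard = (linePoints P a b).card := by
  rw [← Set.ncard_coe_finset]
  congr 1
  ext p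
  simp only [Set.mem_inter_iff, SetLike.mem_coe, mem_linePoints,
    mem_line_iff_cross hab]

theorem isOrdinaryTriangle_of_cross_ne_zero [DecidableEq Plane] {P : Finset Plane} {k : ℕ}
    {a b c : Plane}
    (ha : a ∈ P) (hb : b ∈ P) (hc : c ∈ P) (h : cross a b c ≠ 0)
    (hab : (linePoints P a b).card ≤ k) (hac : (linePoints P a c).card ≤ k)
    (hbc : (linePoints P b c).card ≤ k) : IsOrdinaryTriangle k P {a, b, c} := by
  have nab : a ≠ b := by rintro rfl; exact h (cross_self_left _ _)
  have nbc : b ≠ c := by rintro rfl; exact h (cross_self_right _ _)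
  have nac : a ≠ c := by rintro rfl; exact h (cross_self_outer _ _)
  refine ⟨?_, Finset.card_eq_three.2 ⟨a, b, c, nab, nac, nbc, rfl⟩, ?_, ?_⟩
  · intro x hx
    simp only [Finset.mem_insert, Finset.mem_singleton] at hx
    rcases hx with rfl | rfl | rfl <;> assumption
  · simpa using not_collinear_of_cross_ne_zero h
  · intro p hp q hq hpq
    rw [ncard_inter_line hpq]
    simp only [Finset.mem_insert, Finset.mem_singleton] at hp hq
    rcases hp with rfl | rfl | rfl <;> rcases hq with rfl | rfl | rfl <;>
      first
        | exact absurd rfl hpq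
        | assumption
        | (rw [linePoints_comm]; assumption)

theorem IsOrdinaryTriangle.mono {P T : Finset Plane} {k k' : ℕ} (h : IsOrdinaryTriangle k P T)
    (hk : k ≤ k') : IsOrdinaryTriangle k' P T :=
  ⟨h.1, h.2.1, h.2.2.1, fun p hp q hq hpq => (h.2.2.2 p hp q hq hpq).trans hk⟩

theorem mem_ordinaryTriangles {P T : Finset Plane} {k : ℕ} :
    T ∈ ordinaryTriangles k P ↔ IsOrdinaryTriangle k P T := by
  simp only [ordinaryTriangles, Finset.mem_filter, Finset.mem_powerset]
  exact ⟨fun h => h.2, fun h => ⟨h.1, h⟩⟩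

theorem card_ordinaryTriangles_mono (P : Finset Plane) {k k' : ℕ} (hk : k ≤ k') :
    (ordinaryTriangles k P).card ≤ (ordinaryTriangles k' P).card :=
  Finset.card_le_card fun _ hT =>
    mem_ordinaryTriangles.2 ((mem_ordinaryTriangles.1 hT).mono hk)

theorem isLine_affineSpan_pair {a b : Plane} (hab : a ≠ b) : IsLine line[ℝ, a, b] := by
  refine ⟨⟨a, left_mem_affineSpan_pair ℝ a b⟩, ?_⟩
  rw [direction_affineSpan, vectorSpan_pair_rev]
  exact finrank_span_singleton (vsub_ne_zero.2 hab.symm)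

/-- Collinear points are contained in a line. -/
theorem exists_isLine_of_cross_eq_zero (S : Finset Plane)
    (h : ∀ a ∈ S, ∀ b ∈ S, ∀ c ∈ S, cross a b c = 0) :
    ∃ L : AffineSubspace ℝ Plane, IsLine L ∧ (S : Set Plane) ⊆ L := by
  by_cases hS : ∃ a ∈ S, ∃ b ∈ S, a ≠ b
  · obtain ⟨a, ha, b, hb, hab⟩ := hS
    exact ⟨_, isLine_affineSpan_pair hab,
      fun c hc => (mem_line_iff_cross hab).2 (h a ha b hb c hc)⟩
  · push Not at hS
    rcases S.eq_empty_or_nonempty with rfl | ⟨a, ha⟩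
    · obtain ⟨a, b, hab⟩ := exists_pair_ne Plane
      exact ⟨_, isLine_affineSpan_pair hab, by simp⟩
    · obtain ⟨b, hb⟩ := exists_ne a
      refine ⟨_, isLine_affineSpan_pair hb.symm, fun c hc => ?_⟩
      rw [← hS a ha c hc]
      exact left_mem_affineSpan_pair ℝ a b

theorem dist_sq_plane (a b : Plane) : dist a b ^ 2 = (a 0 - b 0) ^ 2 + (a 1 - b 1) ^ 2 := by
  rw [EuclideanSpace.dist_eq, Real.sq_sqrt (by positivity)]
  simp [Fin.sum_univ_two, Real.dist_eq, sq_abs]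

/-- The height of `p` over a line, area divided by base, does not depend on the base chosen on that
line. -/
theorem cross_sq_mul_dist_sq {a b q r p : Plane} (hab : a ≠ b) (hq : cross a b q = 0)
    (hr : cross a b r = 0) :
    cross q r p ^ 2 * dist a b ^ 2 = cross a b p ^ 2 * dist q r ^ 2 := by
  obtain ⟨s, q0, q1⟩ := exists_param_of_cross_eq_zero hab hq
  obtain ⟨t, r0, r1⟩ := exists_param_of_cross_eq_zero hab hr
  simp only [dist_sq_plane, cross, q0, q1, r0, r1]
  ring

/-- Of three points `u`, `v`, `w` in order on a line, the middle one is closer to some other one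
than `p` is, for any `p` not on the line. -/
theorem dist_lt_of_wbtw {u v w p : Plane} (h : Wbtw ℝ u v w) (huw : u ≠ w)
    (hp : cross u w p ≠ 0) : dist u v < dist u p ∨ dist w v < dist w p := by
  by_contra! hcon
  have h1 := h.dist_add_dist
  have h2 := dist_triangle u p w
  rw [dist_comm v w] at h1
  rw [dist_comm p w] at h2
  have h3 : dist u p + dist p w = dist u w := by
    rw [dist_comm p w]
    linarith [hcon.1, hcon.2]
  have h4 : Wbtw ℝ u p w := dist_add_dist_eq_iff.1 h3
  exact hp ((mem_line_iff_cross huw).1 h4.mem_affineSpan)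

/-- The Sylvester–Gallai theorem. -/
theorem sylvester_gallai {S : Finset Plane}
    (h : ∃ a ∈ S, ∃ b ∈ S, ∃ c ∈ S, cross a b c ≠ 0) :
    ∃ a ∈ S, ∃ b ∈ S, a ≠ b ∧ ∀ c ∈ S, cross a b c = 0 → c = a ∨ c = b := by
  classical
  obtain ⟨x, hx, y, hy, z, hz, hxyz⟩ := h
  -- Kelly's extremal choice: the minimised quantity is the squared distance from `p` to the line `a
  -- b`.
  obtain ⟨⟨a, b, p⟩, hmem, hmin⟩ := ((S ×ˢ S ×ˢ S).filter
    (fun t => cross t.1 t.2.1 t.2.2 ≠ 0)).exists_min_image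
    (fun t => cross t.1 t.2.1 t.2.2 ^ 2 / dist t.1 t.2.1 ^ 2)
    ⟨(x, y, z), by simp [hx, hy, hz, hxyz]⟩
  simp only [Finset.mem_filter, Finset.mem_product] at hmem hmin
  obtain ⟨⟨ha, hb, hp⟩, hne⟩ := hmem
  have hab : a ≠ b := by rintro rfl; exact hne (cross_self_left _ _)
  -- In the triangle `q r p`, a side `q p` longer than `q r` has a shorter height, so `r` would be
  -- closer to the line `q p` than `p` is to `a b`.
  have key : ∀ q ∈ S, ∀ r ∈ S, q ≠ r → cross a b q = 0 → cross a b r = 0 →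
      ¬ dist q r < dist q p := by
    intro q hq r hr hqr cq cr hlt
    have hqrp : cross q r p ≠ 0 := fun h =>
      hne ((cross_eq_zero_iff_of_two hab hqr cq cr p).1 h)
    have h1 := hmin (q, p, r) ⟨⟨hq, hp, hr⟩, by rw [cross_swap_right]; exact neg_ne_zero.2 hqrp⟩
    have h2 := cross_sq_mul_dist_sq (p := p) hab cq cr
    have d1 : 0 < dist a b ^ 2 := pow_pos (dist_pos.2 hab) 2
    have d2 : 0 < dist q r ^ 2 := pow_pos (dist_pos.2 hqr) 2
    have d3 : dist q r ^ 2 < dist q p ^ 2 := pow_lt_pow_left₀ hlt dist_nonneg two_ne_zero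
    have h3 : cross a b p ^ 2 / dist a b ^ 2 = cross q r p ^ 2 / dist q r ^ 2 := by
      rw [div_eq_div_iff d1.ne' d2.ne', h2]
    simp only at h1
    rw [h3, cross_swap_right q r p, neg_sq] at h1
    have h4 := div_lt_div_of_pos_left (pow_pos (abs_pos.2 hqrp) 2) d2 d3
    rw [sq_abs] at h4
    linarith
  have key2 : ∀ u ∈ S, ∀ v ∈ S, ∀ w ∈ S, u ≠ v → v ≠ w → u ≠ w → cross a b u = 0 →
      cross a b v = 0 → cross a b w = 0 → ¬ Wbtw ℝ u v w := by
    intro u hu v hv w hw huv hvw huw cu cv cw hbtw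
    have hp' : cross u w p ≠ 0 := fun h => hne ((cross_eq_zero_iff_of_two hab huw cu cw p).1 h)
    rcases dist_lt_of_wbtw hbtw huw hp' with h | h
    · exact key u hu v hv huv cu cv h
    · exact key w hw v hv hvw.symm cw cv h
  refine ⟨a, ha, b, hb, hab, fun c hc habc => ?_⟩
  by_contra! hcon
  obtain ⟨hca, hcb⟩ := hcon
  have hcol : Collinear ℝ ({c, a, b} : Set Plane) :=
    collinear_insert_of_mem_affineSpan_pair ((mem_line_iff_cross hab).2 habc)
  rcases hcol.wbtw_or_wbtw_or_wbtw with h | h | h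
  · exact key2 c hc a ha b hb hca hab hcb habc (cross_self_outer _ _) (cross_self_right _ _) h
  · exact key2 a ha b hb c hc hab hcb.symm hca.symm (cross_self_outer _ _) (cross_self_right _ _)
      habc h
  · exact key2 b hb c hc a ha hcb.symm hca hab.symm (cross_self_right _ _) habc
      (cross_self_outer _ _) h

end PlaneGeometry

/-! ### Rich pairs, and triples that avoid them. -/

section PairCounting

/-- The incidence bounds need distinct abscissae; each pair of points excludes at most one shear
parameter. -/
theorem exists_injOn_shear (P : Finset Plane) :
    ∃ t : ℝ, Set.InjOn (fun p : Plane => p 0 + t * p 1) P := by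
  classical
  obtain ⟨t, ht⟩ := Infinite.exists_notMem_finset
    ((P ×ˢ P).image (fun z : Plane × Plane => -(z.1 0 - z.2 0) / (z.1 1 - z.2 1)))
  refine ⟨t, fun p hp q hq h => ?_⟩
  simp only at h
  by_cases h1 : p 1 - q 1 = 0
  · have h1' : p 1 = q 1 := by linarith
    rw [h1'] at h
    exact plane_ext (by linarith) h1'
  · refine absurd (Finset.mem_image.2 ⟨(p, q), Finset.mem_product.2 ⟨hp, hq⟩, ?_⟩) ht
    rw [div_eq_iff h1]
    linarith

open Classical in
/-- The ordered pairs of distinct points of `P` whose line contains more than `c` points. -/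
noncomputable def richPairs (c : ℕ) (P : Finset Plane) : Finset (Plane × Plane) :=
  P.offDiag.filter (fun e => c < (linePoints P e.1 e.2).card)

theorem mem_richPairs {c : ℕ} {P : Finset Plane} {e : Plane × Plane} :
    e ∈ richPairs c P ↔ e.1 ∈ P ∧ e.2 ∈ P ∧ e.1 ≠ e.2 ∧ c < (linePoints P e.1 e.2).card := by
  classical
  simp [richPairs, Finset.mem_offDiag, and_assoc]

/-- If no line contains more than `K` points, then few pairs span a line with more than `c`
points. -/
theorem card_richPairs_le (P : Finset Plane) {c K : ℕ} (hc : 2 ≤ c)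
    (hK : ∀ a ∈ P, ∀ b ∈ P, a ≠ b → (linePoints P a b).card ≤ K) :
    ((richPairs c P).card : ℝ) ≤ 48 * P.card * K + 2304 * (P.card : ℝ) ^ 2 / c := by
  classical
  obtain ⟨t, ht⟩ := exists_injOn_shear P
  set X : Plane → ℝ := fun p => p 0 + t * p 1 with hX
  set Y : Plane → ℝ := fun p => p 1 with hY
  set φ : Plane × Plane → ℝ × ℝ := fun e =>
    (segSlope X Y e, Y e.1 - segSlope X Y e * X e.1) with hφ
  have htr : ∀ a ∈ P, ∀ b ∈ P, a ≠ b → trace X Y P (φ (a, b)) = linePoints P a b := by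
    intro a ha b hb hab
    have hne : X b - X a ≠ 0 := fun h => hab (ht ha hb (sub_eq_zero.1 h).symm)
    ext p
    rw [mem_trace, mem_linePoints]
    refine and_congr_right fun _ => ?_
    -- A shear preserves signed area, so the sheared line equation, cleared of its denominator, is
    -- `cross` in the original coordinates.
    have h1 : (Y p - (segSlope X Y (a, b) * X p + (Y a - segSlope X Y (a, b) * X a))) *
        (X b - X a) = cross a b p := by
      have h2 : segSlope X Y (a, b) * (X b - X a) = Y b - Y a := div_mul_cancel₀ _ hne
      have h3 : (Y p - (segSlope X Y (a, b) * X p + (Y a - segSlope X Y (a, b) * X a))) *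
          (X b - X a) = (Y p - Y a) * (X b - X a) -
            segSlope X Y (a, b) * (X b - X a) * (X p - X a) := by ring
      rw [h3, h2]
      simp only [hX, hY, cross]
      ring
    rw [← h1, mul_eq_zero, or_iff_left hne, sub_eq_zero]
  have hbound := sum_sq_card_trace_le (Y := Y) ht ((richPairs c P).image φ) (K := K) hc (by
    intro l hl
    obtain ⟨e, he, rfl⟩ := Finset.mem_image.1 hl
    obtain ⟨h1, h2, h3, h4⟩ := mem_richPairs.1 he
    have := htr e.1 h1 e.2 h2 h3
    rw [Prod.mk.eta] at this
    rw [this]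
    exact ⟨h4.le, hK _ h1 _ h2 h3⟩)
  refine le_trans ?_ hbound
  -- Group the pairs by their line; each fibre embeds in the square of the line's point set.
  rw [Finset.card_eq_sum_card_image φ, Nat.cast_sum]
  refine Finset.sum_le_sum fun l hl => ?_
  rw [sq, ← Nat.cast_mul, ← Finset.card_product]
  refine Nat.cast_le.2 (Finset.card_le_card fun e he => ?_)
  obtain ⟨heR, rfl⟩ := Finset.mem_filter.1 he
  obtain ⟨h1, h2, h3, -⟩ := mem_richPairs.1 heR
  have := htr e.1 h1 e.2 h2 h3
  rw [Prod.mk.eta] at this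
  rw [this]
  exact Finset.mem_product.2 ⟨mem_linePoints.2 ⟨h1, cross_self_outer _ _⟩,
    mem_linePoints.2 ⟨h2, cross_self_right _ _⟩⟩

/-- Few rich pairs leave many ordinary triangles. -/
theorem card_ordinaryTriangles_of_richPairs (P : Finset Plane) (c : ℕ) :
    P.card ^ 3 ≤ 27 * (ordinaryTriangles c P).card + 3 * (P.card * (richPairs c P).card) +
      (c + 1) * P.card ^ 2 := by
  classical
  set n := P.card with hn
  set R := richPairs c P with hR
  set A := P ×ˢ P ×ˢ P with hA
  set G := A.filter (fun x => cross x.1 x.2.1 x.2.2 ≠ 0 ∧ (x.1, x.2.1) ∉ R ∧ (x.1, x.2.2) ∉ R ∧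
    (x.2.1, x.2.2) ∉ R) with hG
  set D := A.filter (fun x => x.1 = x.2.1) with hD
  set C := A.filter (fun x => x.1 ≠ x.2.1 ∧ (x.1, x.2.1) ∉ R ∧ cross x.1 x.2.1 x.2.2 = 0) with hC
  set B₁ := A.filter (fun x => (x.1, x.2.1) ∈ R) with hB₁
  set B₂ := A.filter (fun x => (x.1, x.2.2) ∈ R) with hB₂
  set B₃ := A.filter (fun x => (x.2.1, x.2.2) ∈ R) with hB₃
  have memA : ∀ {x}, x ∈ A ↔ x.1 ∈ P ∧ x.2.1 ∈ P ∧ x.2.2 ∈ P := by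
    intro x
    simp only [hA, Finset.mem_product]
  have good : ∀ {a b}, a ∈ P → b ∈ P → a ≠ b → (a, b) ∉ R → (linePoints P a b).card ≤ c := by
    intro a b ha hb hab h
    by_contra! hlt
    exact h (mem_richPairs.2 ⟨ha, hb, hab, hlt⟩)
  -- A triple that is not good contains a rich pair, or repeats its first two points, or has its
  -- third point among the at most `c` points on the poor line through the first two.
  have hcov : A ⊆ G ∪ D ∪ C ∪ B₁ ∪ B₂ ∪ B₃ := by
    intro x hx
    simp only [hG, hD, hC, hB₁, hB₂, hB₃, Finset.mem_union, Finset.mem_filter, hx, true_and]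
    tauto
  have cA : A.card = n ^ 3 := by
    rw [hA, Finset.card_product, Finset.card_product]
    ring
  have cG : G.card ≤ 27 * (ordinaryTriangles c P).card := by
    have h1 : G.card ≤ 27 * (G.image (fun x => ({x.1, x.2.1, x.2.2} : Finset Plane))).card := by
      refine Finset.card_le_mul_card_image G 27 fun T hT => ?_
      have hT3 : T.card ≤ 3 := by
        obtain ⟨x, -, rfl⟩ := Finset.mem_image.1 hT
        exact Finset.card_le_three
      have h2 : G.filter (fun x => ({x.1, x.2.1, x.2.2} : Finset Plane) = T) ⊆ T ×ˢ T ×ˢ T := by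
        intro x hx
        obtain ⟨-, rfl⟩ := Finset.mem_filter.1 hx
        simp
      refine (Finset.card_le_card h2).trans ?_
      rw [Finset.card_product, Finset.card_product]
      calc T.card * (T.card * T.card) ≤ 3 * (3 * 3) :=
            Nat.mul_le_mul hT3 (Nat.mul_le_mul hT3 hT3)
        _ = 27 := rfl
    refine h1.trans (Nat.mul_le_mul_left _ (Finset.card_le_card fun T hT => ?_))
    obtain ⟨x, hx, rfl⟩ := Finset.mem_image.1 hT
    obtain ⟨hxA, h0, h1, h2, h3⟩ := Finset.mem_filter.1 hx
    obtain ⟨ha, hb, hc⟩ := memA.1 hxA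
    refine mem_ordinaryTriangles.2 (isOrdinaryTriangle_of_cross_ne_zero ha hb hc h0
      (good ha hb (fun h => h0 ?_) h1) (good ha hc (fun h => h0 ?_) h2)
      (good hb hc (fun h => h0 ?_) h3))
    · rw [h, cross_self_left]
    · rw [h, cross_self_outer]
    · rw [h, cross_self_right]
  have cD : D.card ≤ n ^ 2 := by
    have : D.card ≤ (P ×ˢ P).card := by
      refine Finset.card_le_card_of_injOn (fun x => x.2) (fun x hx => ?_) (fun x hx y hy h => ?_)
      · have := memA.1 (Finset.mem_filter.1 hx).1
        exact Finset.mem_product.2 this.2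
      · have h1 := (Finset.mem_filter.1 hx).2
        have h2 := (Finset.mem_filter.1 hy).2
        simp only at h
        exact Prod.ext (by rw [h1, h2, h]) h
    rwa [Finset.card_product, ← sq] at this
  have cC : C.card ≤ c * n ^ 2 := by
    have : C.card ≤ c * (P ×ˢ P).card := by
      refine Finset.card_le_mul_card_image_of_maps_to (f := fun x => (x.1, x.2.1))
        (fun x hx => ?_) c (fun e he => ?_)
      · have := memA.1 (Finset.mem_filter.1 hx).1
        exact Finset.mem_product.2 ⟨this.1, this.2.1⟩
      · rcases (C.filter (fun x => (x.1, x.2.1) = e)).eq_empty_or_nonempty with h | ⟨y, hy⟩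
        · simp [h]
        · obtain ⟨hyC, rfl⟩ := Finset.mem_filter.1 hy
          obtain ⟨hyA, hy1, hy2, -⟩ := Finset.mem_filter.1 hyC
          have hy' := memA.1 hyA
          refine le_trans ?_ (good hy'.1 hy'.2.1 hy1 hy2)
          refine Finset.card_le_card_of_injOn (fun x => x.2.2) (fun x hx => ?_)
            (fun x hx z hz h => ?_)
          · obtain ⟨hxC, hxe⟩ := Finset.mem_filter.1 hx
            obtain ⟨hxA, -, -, hx3⟩ := Finset.mem_filter.1 hxC
            obtain ⟨e1, e2⟩ := Prod.mk.inj hxe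
            rw [e1, e2] at hx3
            exact mem_linePoints.2 ⟨(memA.1 hxA).2.2, hx3⟩
          · have h1 := Prod.mk.inj (Finset.mem_filter.1 hx).2
            have h2 := Prod.mk.inj (Finset.mem_filter.1 hz).2
            exact Prod.ext (h1.1.trans h2.1.symm) (Prod.ext (h1.2.trans h2.2.symm) h)
    rwa [Finset.card_product, ← sq] at this
  have cB : ∀ (S : Finset (Plane × Plane × Plane)) (f : Plane × Plane × Plane → Plane)
      (g : Plane × Plane × Plane → Plane × Plane), (∀ x ∈ S, f x ∈ P ∧ g x ∈ R) →
      (∀ x y, f x = f y → g x = g y → x = y) → S.card ≤ n * R.card := by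
    intro S f g h1 h2
    rw [hn, ← Finset.card_product]
    exact Finset.card_le_card_of_injOn (fun x => (f x, g x))
      (fun x hx => Finset.mem_product.2 (h1 x hx))
      (fun x _ y _ h => h2 x y (Prod.mk.inj h).1 (Prod.mk.inj h).2)
  have cB₁ : B₁.card ≤ n * R.card := cB B₁ (fun x => x.2.2) (fun x => (x.1, x.2.1))
    (fun x hx => ⟨(memA.1 (Finset.mem_filter.1 hx).1).2.2, (Finset.mem_filter.1 hx).2⟩)
    (by rintro ⟨a, b, d⟩ ⟨a', b', d'⟩ h1 h2; simp_all)
  have cB₂ : B₂.card ≤ n * R.card := cB B₂ (fun x => x.2.1) (fun x => (x.1, x.2.2))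
    (fun x hx => ⟨(memA.1 (Finset.mem_filter.1 hx).1).2.1, (Finset.mem_filter.1 hx).2⟩)
    (by rintro ⟨a, b, d⟩ ⟨a', b', d'⟩ h1 h2; simp_all)
  have cB₃ : B₃.card ≤ n * R.card := cB B₃ (fun x => x.1) (fun x => (x.2.1, x.2.2))
    (fun x hx => ⟨(memA.1 (Finset.mem_filter.1 hx).1).1, (Finset.mem_filter.1 hx).2⟩)
    (by rintro ⟨a, b, d⟩ ⟨a', b', d'⟩ h1 h2; simp_all)
  have u5 := Finset.card_union_le (G ∪ D ∪ C ∪ B₁ ∪ B₂) B₃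
  have u4 := Finset.card_union_le (G ∪ D ∪ C ∪ B₁) B₂
  have u3 := Finset.card_union_le (G ∪ D ∪ C) B₁
  have u2 := Finset.card_union_le (G ∪ D) C
  have u1 := Finset.card_union_le G D
  have u0 := Finset.card_le_card hcov
  have e1 : (c + 1) * n ^ 2 = c * n ^ 2 + n ^ 2 := by ring
  rw [cA] at u0
  rw [e1]
  omega

end PairCounting

/-! ### The case of a very rich line. -/

section RichLine

/-- If a line contains many points of `P` and the other points are not collinear, then almost
every point on the line belongs to a `c`-ordinary triangle with two fixed other points. -/
theorem card_linePoints_le_of_not_covered {P : Finset Plane} (hP : ¬ CoveredByTwoLines P)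
    {u v : Plane} (huv : u ≠ v) {c : ℕ} (hc : 3 ≤ c) :
    (c - 1) * (linePoints P u v).card ≤
      (c - 1) * ((ordinaryTriangles c P).card + 1) + 2 * P.card := by
  classical
  set L := linePoints P u v with hL
  set S := P \ L with hS
  have hSL : ∀ {s}, s ∈ S → s ∈ P ∧ cross u v s ≠ 0 := by
    intro s hs
    obtain ⟨h1, h2⟩ := Finset.mem_sdiff.1 hs
    exact ⟨h1, fun h => h2 (mem_linePoints.2 ⟨h1, h⟩)⟩
  have hnc : ∃ a ∈ S, ∃ b ∈ S, ∃ d ∈ S, cross a b d ≠ 0 := by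
    by_contra! h
    obtain ⟨L', hL', hSL'⟩ := exists_isLine_of_cross_eq_zero S h
    refine hP ⟨_, L', isLine_affineSpan_pair huv, hL', fun p hp => ?_⟩
    by_cases hpL : p ∈ L
    · exact Or.inl ((mem_line_iff_cross huv).2 (mem_linePoints.1 hpL).2)
    · exact Or.inr (hSL' (Finset.mem_coe.2 (Finset.mem_sdiff.2 ⟨hp, hpL⟩)))
  obtain ⟨a, ha, b, hb, hab, hord⟩ := sylvester_gallai hnc
  have hone : ∀ s ∈ S, ∀ z, ∀ p ∈ L, ∀ q ∈ L, s ≠ z → cross s z p = 0 → cross s z q = 0 →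
      p = q := by
    intro s hs z p hp q hq hsz h1 h2
    by_contra hpq
    refine (hSL hs).2 (cross_eq_zero_of_two hpq (mem_linePoints.1 hp).2 (mem_linePoints.1 hq).2 ?_)
    exact (cross_eq_zero_iff_of_two hsz hpq h1 h2 s).2 (cross_self_outer _ _)
  have hne : ∀ s ∈ S, ∀ p ∈ L, s ≠ p := by
    rintro s hs p hp rfl
    exact (Finset.mem_sdiff.1 hs).2 hp
  have hab3 : (linePoints P a b).card ≤ 3 := by
    have h1 : (L.filter (fun p => cross a b p = 0)).card ≤ 1 :=
      Finset.card_le_one.2 fun p hp q hq =>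
        hone a ha b p (Finset.mem_filter.1 hp).1 q (Finset.mem_filter.1 hq).1 hab
          (Finset.mem_filter.1 hp).2 (Finset.mem_filter.1 hq).2
    have h2 : linePoints P a b ⊆ {a, b} ∪ L.filter (fun p => cross a b p = 0) := by
      intro p hp
      obtain ⟨hpP, hp0⟩ := mem_linePoints.1 hp
      by_cases hpL : p ∈ L
      · exact Finset.mem_union_right _ (Finset.mem_filter.2 ⟨hpL, hp0⟩)
      · refine Finset.mem_union_left _ ?_
        simpa using hord p (Finset.mem_sdiff.2 ⟨hpP, hpL⟩) hp0
    have h3 := Finset.card_le_card h2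
    have h4 := Finset.card_union_le ({a, b} : Finset Plane) (L.filter (fun p => cross a b p = 0))
    have h5 := Finset.card_le_two (a := a) (b := b)
    omega
  -- Distinct lines through `s` share only `s`. A rich one has at least `c + 1` points, so at least
  -- `c - 1` remain after removing `s` and `p`.
  have hbad : ∀ s ∈ S, (c - 1) * (L.filter (fun p => c < (linePoints P s p).card)).card ≤
      P.card := by
    intro s hs
    set Q := L.filter (fun p => c < (linePoints P s p).card) with hQ
    have hdisj : ∀ p ∈ Q, ∀ q ∈ Q, p ≠ q →
        Disjoint (linePoints P s p \ {s, p}) (linePoints P s q \ {s, q}) := by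
      intro p hp q hq hpq
      have hpL := (Finset.mem_filter.1 hp).1
      have hqL := (Finset.mem_filter.1 hq).1
      refine Finset.disjoint_left.2 fun x hx hx' => hpq ?_
      obtain ⟨h1, h2⟩ := Finset.mem_sdiff.1 hx
      obtain ⟨h1', -⟩ := Finset.mem_sdiff.1 hx'
      have hsx : s ≠ x := by
        rintro rfl
        simp at h2
      refine hone s hs x p hpL q hqL hsx ?_ ?_
      · rw [cross_swap_right, (mem_linePoints.1 h1).2, neg_zero]
      · rw [cross_swap_right, (mem_linePoints.1 h1').2, neg_zero]
    have h1 : (Q.biUnion (fun p => linePoints P s p \ {s, p})).card ≤ P.card := by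
      refine Finset.card_le_card fun x hx => ?_
      obtain ⟨p, -, hx⟩ := Finset.mem_biUnion.1 hx
      exact (mem_linePoints.1 (Finset.mem_sdiff.1 hx).1).1
    rw [Finset.card_biUnion hdisj] at h1
    refine le_trans ?_ h1
    rw [mul_comm, ← smul_eq_mul]
    refine Finset.card_nsmul_le_sum Q _ (c - 1) fun p hp => ?_
    have h2 := (Finset.mem_filter.1 hp).2
    have h3 := Finset.le_card_sdiff ({s, p} : Finset Plane) (linePoints P s p)
    have h4 := Finset.card_le_two (a := s) (b := p)
    omega
  set Qa := L.filter (fun p => c < (linePoints P a p).card) with hQa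
  set Qb := L.filter (fun p => c < (linePoints P b p).card) with hQb
  set N := L.filter (fun p => cross a b p = 0) with hN
  set G := L.filter (fun p => cross a b p ≠ 0 ∧ (linePoints P a p).card ≤ c ∧
    (linePoints P b p).card ≤ c) with hG
  have hNc : N.card ≤ 1 :=
    Finset.card_le_one.2 fun p hp q hq =>
      hone a ha b p (Finset.mem_filter.1 hp).1 q (Finset.mem_filter.1 hq).1 hab
        (Finset.mem_filter.1 hp).2 (Finset.mem_filter.1 hq).2
  have hcov : L ⊆ G ∪ N ∪ Qa ∪ Qb := by
    intro p hp
    simp only [hG, hN, hQa, hQb, Finset.mem_union, Finset.mem_filter, hp, true_and, ← not_lt]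
    tauto
  have hGc : G.card ≤ (ordinaryTriangles c P).card := by
    refine Finset.card_le_card_of_injOn (fun p => {a, b, p}) (fun p hp => ?_)
      (fun p hp q hq h => ?_)
    · obtain ⟨hpL, h0, h1, h2⟩ := Finset.mem_filter.1 hp
      exact mem_ordinaryTriangles.2 (isOrdinaryTriangle_of_cross_ne_zero (hSL ha).1 (hSL hb).1
        (mem_linePoints.1 hpL).1 h0 (hab3.trans hc) h1 h2)
    · have hpL := (Finset.mem_filter.1 hp).1
      have hpq : p ∈ ({a, b, q} : Finset Plane) := by
        simp only at h
        rw [← h]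
        simp
      simp only [Finset.mem_insert, Finset.mem_singleton] at hpq
      rcases hpq with h | h | h
      · exact absurd h.symm (hne a ha p hpL)
      · exact absurd h.symm (hne b hb p hpL)
      · exact h
  have u0 := Finset.card_le_card hcov
  have u3 := Finset.card_union_le (G ∪ N ∪ Qa) Qb
  have u2 := Finset.card_union_le (G ∪ N) Qa
  have u1 := Finset.card_union_le G N
  have hQa' : (c - 1) * Qa.card ≤ P.card := hbad a ha
  have hQb' : (c - 1) * Qb.card ≤ P.card := hbad b hb
  calc (c - 1) * L.card ≤ (c - 1) * ((ordinaryTriangles c P).card + 1 + Qa.card + Qb.card) :=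
        Nat.mul_le_mul_left _ (by omega)
    _ = (c - 1) * ((ordinaryTriangles c P).card + 1) + (c - 1) * Qa.card +
        (c - 1) * Qb.card := by ring
    _ ≤ _ := by omega

end RichLine

/-! ### Choice of constants and conclusion. -/

theorem exists_cross_ne_zero_of_not_covered {P : Finset Plane} (hP : ¬ CoveredByTwoLines P) :
    ∃ a ∈ P, ∃ b ∈ P, ∃ c ∈ P, cross a b c ≠ 0 := by
  by_contra! h
  obtain ⟨L, hL, hPL⟩ := exists_isLine_of_cross_eq_zero P h
  exact hP ⟨L, L, hL, hL, fun p hp => Or.inl (hPL hp)⟩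

theorem exists_isOrdinaryTriangle_of_card_le {P : Finset Plane} (hP : ¬ CoveredByTwoLines P)
    {c : ℕ} (hc : P.card ≤ c) : ∃ T, IsOrdinaryTriangle c P T := by
  classical
  obtain ⟨x, hx, y, hy, z, hz, h⟩ := exists_cross_ne_zero_of_not_covered hP
  have hle : ∀ a b, (linePoints P a b).card ≤ c := fun a b =>
    (Finset.card_le_card fun p hp => (mem_linePoints.1 hp).1).trans hc
  exact ⟨_, isOrdinaryTriangle_of_cross_ne_zero hx hy hz h (hle _ _) (hle _ _) (hle _ _)⟩

/-- A large set that is not covered by two lines has linearly many ordinary triangles. -/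
theorem card_le_card_ordinaryTriangles {P : Finset Plane} (hP : ¬ CoveredByTwoLines P)
    (hn : 200000 ≤ P.card) : P.card ≤ 2000 * (ordinaryTriangles 65536 P).card := by
  by_cases hrich : ∃ u v : Plane, u ≠ v ∧ P.card / 1000 < (linePoints P u v).card
  · obtain ⟨u, v, huv, h⟩ := hrich
    have h1 := card_linePoints_le_of_not_covered hP huv (c := 65536) (by norm_num)
    -- About `n / 1000` candidates lose `2 n / 65535 + 1`, which leaves more than `n / 2000`.
    omega
  · push Not at hrich
    have h1 := card_richPairs_le P (c := 65536) (K := P.card / 1000) (by norm_num)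
      (fun a _ b _ hab => hrich a b hab)
    have h2 := card_ordinaryTriangles_of_richPairs P 65536
    have h3 : (P.card : ℝ) ^ 3 ≤ 27 * (ordinaryTriangles 65536 P).card +
        3 * (P.card * (richPairs 65536 P).card) + (65536 + 1) * (P.card : ℝ) ^ 2 := by
      exact_mod_cast h2
    have h4 : ((P.card / 1000 : ℕ) : ℝ) ≤ P.card / 1000 := by
      exact_mod_cast Nat.cast_div_le (α := ℝ) (m := P.card) (n := 1000)
    have h5 : (200000 : ℝ) ≤ P.card := by exact_mod_cast hn
    have h6 : (P.card : ℝ) ≤ 2000 * (ordinaryTriangles 65536 P).card := by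
      set n : ℝ := (P.card : ℝ)
      have hn0 : 0 ≤ n := by linarith
      -- The coefficients are `48 / 1000` and `2304 / 65536`, together below `1 / 10`. Rich pairs
      -- then spoil at most `3 / 10` of the triples, and the quadratic term at most `65537 /
      -- 200000`.
      have h7 : ((richPairs 65536 P).card : ℝ) ≤ n ^ 2 / 10 := by
        have h8 := mul_le_mul_of_nonneg_left h4 hn0
        push_cast at h1
        nlinarith [sq_nonneg n]
      have h9 := mul_le_mul_of_nonneg_left h7 hn0
      have h10 : 200000 * n ^ 2 ≤ n * n ^ 2 := mul_le_mul_of_nonneg_right h5 (sq_nonneg n)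
      have h11 : 200000 * n ≤ n * n := mul_le_mul_of_nonneg_right h5 hn0
      nlinarith
    exact_mod_cast h6

theorem theorem1 :
    ∃ c : ℕ, ∃ δ : ℝ, 0 < δ ∧
      ∀ P : Finset Plane, ¬ CoveredByTwoLines P →
        (∃ T : Finset Plane, IsOrdinaryTriangle c P T) ∧
          δ * (P.card : ℝ) ≤ ((ordinaryTriangles c P).card : ℝ) := by
  -- Up to `200000` points every non-collinear triple is ordinary, and a single triangle already
  -- meets the linear bound; this fixes both constants.
  refine ⟨200000, 1 / 200000, by norm_num, fun P hP => ?_⟩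
  suffices h : 0 < (ordinaryTriangles 200000 P).card ∧
      P.card ≤ 200000 * (ordinaryTriangles 200000 P).card by
    refine ⟨?_, ?_⟩
    · obtain ⟨T, hT⟩ := Finset.card_pos.1 h.1
      exact ⟨T, mem_ordinaryTriangles.1 hT⟩
    · have : (P.card : ℝ) ≤ 200000 * (ordinaryTriangles 200000 P).card := by exact_mod_cast h.2
      linarith
  rcases le_total P.card 200000 with hn | hn
  · obtain ⟨T, hT⟩ := exists_isOrdinaryTriangle_of_card_le hP hn
    have : 0 < (ordinaryTriangles 200000 P).card :=
      Finset.card_pos.2 ⟨T, mem_ordinaryTriangles.2 hT⟩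
    exact ⟨this, by omega⟩
  · have h1 := card_le_card_ordinaryTriangles hP hn
    have h2 := card_ordinaryTriangles_mono P (show 65536 ≤ 200000 by norm_num)
    exact ⟨by omega, by omega⟩
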